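/- Consider $N$ users. User $i$ has a local dataset $D_i=(d_{i,1},\dots,d_{i,D})$ of $D\ge 1$ data points; $L(\theta,d)$ is a loss function and $\theta\in\mathbb{R}^K$ the current model. For $C>0$ let $g_{i,j}=\mathrm{clip}(\partial L(\theta,d_{i,j})/\partial\theta,\,C)\in\mathbb{R}^K$, where $\mathrm{clip}(x,C)=Cx/\max(\|x\|_2,C)$, let $G_i=[g_{i,1}\ \cdots\ g_{i,D}]$ and $\Sigma_i=\frac1D G_iG_i^T$. Let $B>0$ and let the sampling weights be Gaussian: $w_i=\frac1D\mathbf 1+\frac{1}{\sqrt{BD}}\xi_i$ with $\xi_i\sim\mathcal N(0,I_D)$ and $w_1,\dots,w_N$ independent (the weights do not depend on the data). The aggregated model update is $x=\sum_{i=1}^N G_iw_i$; write $\mathcal M_{D_1,\dots,D_N}$ for its law. Assume that for every user $i$ the matrix $\Sigma_i$ is non-singular with all eigenvalues at least $\lambda_{i,\min}>0$. If $\frac{C^2}{D}<\sum_{i=1}^N\lambda_{i,\min}$, then for every $\alpha$ with $1<\alpha<\frac{D}{C^2}\sum_{i=1}^N\lambda_{i,\min}$ and for every user $i$, the aggregated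 model update provides, for user $i$'s dataset, $(\alpha,\epsilon)$-RDP with $$\epsilon=\Big(\frac{2\alpha BC^2}{D^2}+\frac{\alpha C^2}{(\alpha-1)D}\Big)\cdot\frac{1}{\sum_{i=1}^N\lambda_{i,\min}-\frac{\alpha C^2}{D}},$$ and $\big(\epsilon+\frac{\log(1/\delta)}{\alpha-1},\delta\big)$-DP for every $\delta>0$. That is, for all datasets $D_1,\dots,D_N$ as above and every $D_i'$ that differs from $D_i$ in one data point, the laws $P=\mathcal M_{D_1,\dots,D_i,\dots,D_N}$ and $Q=\mathcal M_{D_1,\dots,D_i',\dots,D_N}$ satisfy $$\frac{1}{\alpha-1}\log\mathbb{E}_{y\sim Q}\Big[\Big(\frac{dP}{dQ}(y)\Big)^{\alpha}\Big]\le\epsilon,$$ with $P$ absolutely continuous with respect to $Q$, and $P(A)\le e^{\epsilon+\log(1/\delta)/(\alpha-1)}\,Q(A)+\delta$ for all $\delta>0$ and all measurable sets $A$. (If $D_i'$ also satisfies the eigenvalue assumption, the same bounds hold with $P$ and $Q$ interchanged.) -/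

import Mathlib

open MeasureTheory ProbabilityTheory
open scoped ENNReal

noncomputable section

/-! ### Rényi divergence, Rényi differential privacy and differential privacy -/

/-- The Rényi divergence `D_α(P ‖ Q) = 1/(α-1) · log E_{x ∼ Q} [(dP/dQ)(x)^α]` of order `α > 0`,
`α ≠ 1`, as an extended real number. For `α > 1` it is `+∞` when `P` is not absolutely continuous
with respect to `Q`. -/
def renyiDiv {Y : Type*} [MeasurableSpace Y] (α : ℝ) (P Q : Measure Y) : EReal :=
  open Classical in
  if 1 < α ∧ ¬ P ≪ Q then ⊤
  else ((1 / (α - 1) : ℝ) : EReal) * ENNReal.log (∫⁻ y, (P.rnDeriv Q y) ^ α ∂Q)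

/-- `(α, ε)`-Rényi differential privacy of the mechanism `M` (which maps an input to the law of the
output) at every input `x ∈ S`: for all `x'` adjacent to `x`, `D_α(M x ‖ M x') ≤ ε`. The adjacent
input `x'` need not be in `S`. With `S = Set.univ` this is the usual notion; in general it contains
`(α, ε)`-RDP of the mechanism with its inputs restricted to `S`. -/
def IsRDPOn {X Y : Type*} [MeasurableSpace Y] (S : Set X) (adj : X → X → Prop)
    (M : X → Measure Y) (α ε : ℝ) : Prop :=
  ∀ x ∈ S, ∀ x', adj x x' → renyiDiv α (M x) (M x') ≤ (ε : EReal)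

/-- `(ε, δ)`-differential privacy of the mechanism `M` at every input `x ∈ S`: for all `x'` adjacent
to `x` and all events `A`, `M x A ≤ e^ε · M x' A + δ`. The adjacent input `x'` need not be
in `S`. -/
def IsDPOn {X Y : Type*} [MeasurableSpace Y] (S : Set X) (adj : X → X → Prop)
    (M : X → Measure Y) (ε δ : ℝ) : Prop :=
  ∀ x ∈ S, ∀ x', adj x x' → ∀ A : Set Y, MeasurableSet A →
    M x A ≤ ENNReal.ofReal (Real.exp ε) * M x' A + ENNReal.ofReal δ

/-! ### Federated learning with clipped gradients -/

/-- The clipping function `clip(x, C) = C x / max(‖x‖₂, C)`. -/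
def clip {K : ℕ} (x : EuclideanSpace ℝ (Fin K)) (C : ℝ) : EuclideanSpace ℝ (Fin K) :=
  (C / max ‖x‖ C) • x

/-- The matrix `G = [g_1 ⋯ g_D]` whose `j`-th column is the clipped gradient
`g_j = clip(∂L(θ, d_j)/∂θ, C)` of the loss `L` at the current model `θ` and the data
point `d_j`. -/
def gradMatrix {𝒳 : Type*} {K D : ℕ} (L : EuclideanSpace ℝ (Fin K) → 𝒳 → ℝ)
    (θ : EuclideanSpace ℝ (Fin K)) (C : ℝ) (d : Fin D → 𝒳) : Matrix (Fin K) (Fin D) ℝ :=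
  Matrix.of fun a j => clip (gradient (fun ϑ => L ϑ (d j)) θ) C a

/-- The covariance matrix of the gradient noise, `Σ = (1/D) G Gᵀ`. -/
def gradCov {𝒳 : Type*} {K D : ℕ} (L : EuclideanSpace ℝ (Fin K) → 𝒳 → ℝ)
    (θ : EuclideanSpace ℝ (Fin K)) (C : ℝ) (d : Fin D → 𝒳) : Matrix (Fin K) (Fin K) ℝ :=
  (1 / (D : ℝ)) • (gradMatrix L θ C d * (gradMatrix L θ C d).transpose)

/-- The aggregated model update `x = ∑_i G_i w_i` of the `N` users with local datasets `d i` and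
sampling weights `w i`. -/
def aggregatedUpdate {𝒳 : Type*} {N K D : ℕ} (L : EuclideanSpace ℝ (Fin K) → 𝒳 → ℝ)
    (θ : EuclideanSpace ℝ (Fin K)) (C : ℝ) (d : Fin N → Fin D → 𝒳)
    (w : Fin N → EuclideanSpace ℝ (Fin D)) : EuclideanSpace ℝ (Fin K) :=
  ∑ i, WithLp.toLp 2 ((gradMatrix L θ C (d i)).mulVec (w i))

/-- The mechanism that the server observes: it maps the local datasets of all users to the law of
the aggregated model update, for random sampling weights `w` on the probability space `(Ω, μ)`. -/
def aggregatedLaw {Ω : Type*} [MeasurableSpace Ω] (μ : Measure Ω)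
    {𝒳 : Type*} {N K D : ℕ} (w : Fin N → Ω → EuclideanSpace ℝ (Fin D))
    (L : EuclideanSpace ℝ (Fin K) → 𝒳 → ℝ) (θ : EuclideanSpace ℝ (Fin K)) (C : ℝ)
    (d : Fin N → Fin D → 𝒳) : Measure (EuclideanSpace ℝ (Fin K)) :=
  μ.map fun ω => aggregatedUpdate L θ C d fun i => w i ω

/-- Gaussian sampling noise: the weights `w_1, …, w_N` of the users are independent, and
`w_i = 1/D + ξ_i / √(B D)` with `ξ_i ∼ N(0, I_D)`. -/
structure IsGaussianSamplingNoise {Ω : Type*} [MeasurableSpace Ω] (μ : Measure Ω) {N D : ℕ}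
    (B : ℝ) (w : Fin N → Ω → EuclideanSpace ℝ (Fin D)) : Prop where
  indep : iIndepFun w μ
  gaussian : ∀ i, ∃ ξ : Ω → EuclideanSpace ℝ (Fin D),
    HasLaw ξ (stdGaussian (EuclideanSpace ℝ (Fin D))) μ ∧
      ∀ ω j, w i ω j = 1 / (D : ℝ) + 1 / √(B * D) * ξ ω j

/-- The collections of local datasets for which the covariance matrix of every user `i` is
non-singular with all its eigenvalues bounded below by `lam i`. -/
def nonsingularData {𝒳 : Type*} {N K : ℕ} (D : ℕ) (L : EuclideanSpace ℝ (Fin K) → 𝒳 → ℝ)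
    (θ : EuclideanSpace ℝ (Fin K)) (C : ℝ) (lam : Fin N → ℝ) : Set (Fin N → Fin D → 𝒳) :=
  {d | ∀ i, IsUnit (gradCov L θ C (d i)) ∧
    ∀ v : ℝ, Module.End.HasEigenvalue (Matrix.toLin' (gradCov L θ C (d i))) v → lam i ≤ v}

/-- Record-level adjacency for user `i`: the two collections of local datasets agree except possibly
for one data point of user `i`. -/
def adjacentFor {𝒳 : Type*} {N D : ℕ} (i : Fin N) (d d' : Fin N → Fin D → 𝒳) : Prop :=
  (∀ j, j ≠ i → d' j = d j) ∧ ∃ k, ∀ l, l ≠ k → d' i l = d i l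

/-- The privacy bound
`(2 α B C² / D² + α C² / ((α - 1) D)) · 1 / (∑_i λ_i - α C² / D)`. -/
def rdpBound {N : ℕ} (D : ℕ) (B C α : ℝ) (lam : Fin N → ℝ) : ℝ :=
  (2 * α * B * C ^ 2 / (D : ℝ) ^ 2 + α * C ^ 2 / ((α - 1) * D)) *
    (1 / (∑ i, lam i - α * C ^ 2 / D))

end

/-!
The weights are Gaussian, so the aggregated update is Gaussian, with mean `∑_i (1/D) G_i 𝟙` and
covariance matrix `S = (1/B) ∑_i Σ_i` (`aggregatedLaw_eq_multivariateGaussian`, by characteristic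
functions). The eigenvalue assumption gives `S ≥ (∑_i λ_i) / B`. Replacing one clipped gradient `v`
of user `i` by `u` shifts the mean by `(u - v) / D` and turns `S` into
`S' = S + (u uᵀ - v vᵀ) / (B D)`.

For nondegenerate Gaussians `P = N(m, S)` and `Q = N(m', S')` such that `M = α S' + (1 - α) S` is
positive definite, completing the square in the product of powers of the densities gives
`E_Q[(dP/dQ)^α] = (det S^(1-α) det S'^α / det M)^(1/2) · exp (α (α - 1) / 2 · Δᵀ M⁻¹ Δ)`,
where `Δ = m' - m` (`lintegral_rnDeriv_rpow_multivariateGaussian`). Here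
`M = S + α (u uᵀ - v vᵀ) / (B D) ≥ (∑_i λ_i - α C² / D) / B`, which is positive by assumption. As
`‖Δ‖ ≤ 2 C / D`, the exponential accounts for the first summand of the privacy bound. By the matrix
determinant lemma the determinants reduce to those of `2 × 2` matrices, and the elementary
inequality `mul_log_sub_log_le` turns their ratio into the second summand. The differential privacy
guarantee then follows from Markov's inequality for the likelihood ratio
(`measure_le_of_renyiDiv_le`).
-/

/-! ### Real positive definite matrices and rank-two perturbations -/

section LinearAlgebra

open Matrix

variable {n : Type*} [Fintype n]

lemma dotProduct_mulVec_comm_of_posSemidef {S : Matrix n n ℝ} (hS : S.PosSemidef) (x y : n → ℝ) :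
    x ⬝ᵥ S *ᵥ y = y ⬝ᵥ S *ᵥ x := by
  have h : Sᵀ = S := by simpa [IsHermitian, conjTranspose_eq_transpose_of_trivial] using hS.1
  rw [dotProduct_mulVec, ← mulVec_transpose, h, dotProduct_comm]

lemma posDef_of_le_dotProduct_mulVec {S : Matrix n n ℝ} (hS : S.IsHermitian) {c : ℝ} (hc : 0 < c)
    (h : ∀ x, c * (x ⬝ᵥ x) ≤ x ⬝ᵥ S *ᵥ x) : S.PosDef := by
  refine .of_dotProduct_mulVec_pos hS fun x hx => ?_
  have : 0 < x ⬝ᵥ x := by simpa using dotProduct_star_self_pos_iff.2 hx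
  exact (mul_pos hc this).trans_le (by simpa using h x)

variable [DecidableEq n]

lemma mulVec_inv_mulVec {S : Matrix n n ℝ} (hS : S.PosDef) (v : n → ℝ) : S *ᵥ (S⁻¹ *ᵥ v) = v := by
  rw [mulVec_mulVec, mul_nonsing_inv _ (isUnit_iff_ne_zero.2 hS.det_pos.ne'), one_mulVec]

lemma inv_mulVec_mulVec {S : Matrix n n ℝ} (hS : S.PosDef) (v : n → ℝ) : S⁻¹ *ᵥ (S *ᵥ v) = v := by
  rw [mulVec_mulVec, nonsing_inv_mul _ (isUnit_iff_ne_zero.2 hS.det_pos.ne'), one_mulVec]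

/-- The bound `S⁻¹ ≤ c⁻¹` on quadratic forms, from `c ≤ S`. With `y = S⁻¹ v` it is the expansion of
`0 ≤ ‖c y - v‖²`. -/
lemma dotProduct_inv_mulVec_le {S : Matrix n n ℝ} (hS : S.PosDef) {c : ℝ} (hc : 0 < c)
    (h : ∀ x, c * (x ⬝ᵥ x) ≤ x ⬝ᵥ S *ᵥ x) (v : n → ℝ) : v ⬝ᵥ S⁻¹ *ᵥ v ≤ (v ⬝ᵥ v) / c := by
  set y := S⁻¹ *ᵥ v with hy
  have h1 := h y
  rw [hy, mulVec_inv_mulVec hS, ← hy] at h1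
  have h2 : 0 ≤ (c • y - v) ⬝ᵥ (c • y - v) := by
    simpa using dotProduct_star_self_nonneg (c • y - v)
  simp only [sub_dotProduct, dotProduct_sub, smul_dotProduct, dotProduct_smul, smul_eq_mul,
    dotProduct_comm v y] at h2
  rw [le_div_iff₀ hc, dotProduct_comm]
  nlinarith

open scoped MatrixOrder in
/-- The Cauchy–Schwarz inequality for the semi-inner product defined by a positive semidefinite
matrix. -/
lemma sq_dotProduct_mulVec_le {S : Matrix n n ℝ} (hS : S.PosSemidef) (x y : n → ℝ) :
    (x ⬝ᵥ S *ᵥ y) ^ 2 ≤ (x ⬝ᵥ S *ᵥ x) * (y ⬝ᵥ S *ᵥ y) := by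
  obtain ⟨T, rfl⟩ := CStarAlgebra.nonneg_iff_eq_star_mul_self.1 hS.nonneg
  have h : ∀ u v : n → ℝ, u ⬝ᵥ (star T * T) *ᵥ v = (T *ᵥ u) ⬝ᵥ (T *ᵥ v) := fun u v => by
    rw [star_eq_conjTranspose, conjTranspose_eq_transpose_of_trivial, ← mulVec_mulVec,
      dotProduct_mulVec, vecMul_transpose]
  rw [h, h, h]
  simpa [sq, dotProduct] using Finset.sum_mul_sq_le_sq_mul_sq Finset.univ (T *ᵥ x) (T *ᵥ y)

/-- The matrix determinant lemma for the perturbation `t (u uᵀ - v vᵀ)`, which is a product of an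
`n × 2` and a `2 × n` matrix, so that only a `2 × 2` determinant remains. -/
lemma det_add_smul_vecMulVec_sub {S : Matrix n n ℝ} (hS : S.PosDef) (t : ℝ) (u v : n → ℝ) :
    (S + t • (vecMulVec u u - vecMulVec v v)).det =
      S.det * ((1 + t * (u ⬝ᵥ S⁻¹ *ᵥ u)) * (1 - t * (v ⬝ᵥ S⁻¹ *ᵥ v)) +
        t ^ 2 * (u ⬝ᵥ S⁻¹ *ᵥ v) ^ 2) := by
  let U : Matrix n (Fin 2) ℝ := .of fun a b => ![t * u a, -(t * v a)] b
  let V : Matrix (Fin 2) n ℝ := .of ![u, v]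
  have h : t • (vecMulVec u u - vecMulVec v v) = U * V := by
    ext a b
    simp [U, V, Matrix.mul_apply, Fin.sum_univ_two, vecMulVec_apply]
    ring
  have hU0 : U.col 0 = t • u := by ext a; simp [U]
  have hU1 : U.col 1 = (-t) • v := by ext a; simp [U]
  have hV (b : Fin 2) (c : Fin 2) : (V * S⁻¹ * U) b c = V.row b ⬝ᵥ S⁻¹ *ᵥ U.col c := by
    rw [Matrix.mul_assoc]
    rfl
  rw [h, det_add_mul U V (isUnit_iff_ne_zero.2 hS.det_pos.ne'), det_fin_two]
  simp only [Matrix.add_apply, hV, hU0, hU1, one_apply, mulVec_smul, dotProduct_smul, smul_eq_mul]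
  have hsymm := dotProduct_mulVec_comm_of_posSemidef hS.inv.posSemidef v u
  have hV0 : V.row 0 = u := rfl
  have hV1 : V.row 1 = v := rfl
  rw [hV0, hV1, hsymm]
  simp only [zero_ne_one, one_ne_zero, ite_true, ite_false]
  ring

lemma le_dotProduct_mulVec_of_eigenvalues {A : Matrix n n ℝ} (hA : A.IsHermitian) {c : ℝ}
    (h : ∀ v, Module.End.HasEigenvalue (Matrix.toLin' A) v → c ≤ v) (x : n → ℝ) :
    c * (x ⬝ᵥ x) ≤ x ⬝ᵥ A *ᵥ x := by
  have hB : (A - algebraMap ℝ (Matrix n n ℝ) c).IsHermitian := by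
    refine hA.sub ?_
    rw [Algebra.algebraMap_eq_smul_one]
    simp [IsHermitian]
  have hpos : (A - algebraMap ℝ (Matrix n n ℝ) c).PosSemidef := by
    refine hB.posSemidef_iff_eigenvalues_nonneg.2 fun i => ?_
    have h1 : hB.eigenvalues i + c ∈ spectrum ℝ A := by
      have := hB.eigenvalues_mem_spectrum_real i
      rw [← spectrum.sub_singleton_eq] at this
      obtain ⟨a, ha, b, rfl, hab⟩ := this
      rw [← hab]
      simpa using ha
    have := h _ (Module.End.hasEigenvalue_iff_mem_spectrum.2 (by rwa [spectrum_toLin']))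
    simpa using this
  have := hpos.dotProduct_mulVec_nonneg x
  simp [sub_mulVec, Algebra.algebraMap_eq_smul_one, smul_mulVec] at this
  linarith

end LinearAlgebra

/-! ### The scalar inequality for the log-determinants -/

/-- Bounds the log-determinant part of the Rényi divergence. The arguments of the two
logarithms are `det (1 + E)` and `det (1 + α E)` for `E = !![a, r; -r, -b]`, the `2 × 2` matrix to
which the determinant lemma reduces the perturbation. -/
lemma mul_log_sub_log_le {α a b c r : ℝ} (hα : 1 < α) (ha : 0 ≤ a) (hac : a ≤ c) (hb : 0 ≤ b)
    (hbc : b ≤ c) (hc : α * c < 1) (hr : r ^ 2 ≤ a * b) :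
    α * Real.log ((1 + a) * (1 - b) + r ^ 2) -
      Real.log ((1 + α * a) * (1 - α * b) + α ^ 2 * r ^ 2) ≤ 2 * (α * c) / (1 - α * c) := by
  have hα0 : 0 < α := by linarith
  have hαa : 0 ≤ α * a := by positivity
  have hαb : 0 ≤ α * b := by positivity
  have hαac : α * a ≤ α * c := by gcongr
  have hαbc : α * b ≤ α * c := by gcongr
  have hb1 : 0 < 1 - b := by nlinarith
  have hb2 : 0 < 1 - α * b := by linarith
  have hc2 : 0 < 1 - α * c := by linarith
  have h1 : Real.log ((1 + a) * (1 - b) + r ^ 2) ≤ a - b := by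
    refine (Real.log_le_sub_one_of_pos (by positivity)).trans ?_
    nlinarith
  have h2 : Real.log (1 + α * a) + Real.log (1 - α * b) ≤
      Real.log ((1 + α * a) * (1 - α * b) + α ^ 2 * r ^ 2) := by
    rw [← Real.log_mul (by positivity) hb2.ne']
    exact Real.log_le_log (by positivity) (le_add_of_nonneg_right (by positivity))
  -- The terms in `a` and in `b` contribute at most `α c / (1 - α c)` each.
  have h3 : 0 ≤ Real.log (1 + α * a) := Real.log_nonneg (by linarith)
  have h4 : 1 - (1 - α * b)⁻¹ ≤ Real.log (1 - α * b) := Real.one_sub_inv_le_log_of_pos hb2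
  have h5 : (1 - α * b)⁻¹ - 1 - α * b ≤ α * c / (1 - α * c) := by
    have : (1 - α * b)⁻¹ - 1 = α * b / (1 - α * b) := by field_simp; ring
    rw [this]
    have : α * b / (1 - α * b) ≤ α * c / (1 - α * c) :=
      div_le_div₀ (hαb.trans hαbc) hαbc hc2 (by linarith)
    linarith
  have h6 : α * c ≤ α * c / (1 - α * c) := by
    rw [le_div_iff₀ hc2]; nlinarith
  have h7 := mul_le_mul_of_nonneg_left h1 hα0.le
  rw [two_mul, add_div]
  linarith

/-! ### The Lebesgue density of a nondegenerate Gaussian -/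

section GaussianDensity

open Matrix WithLp
open scoped MatrixOrder

variable {ι : Type*} [Fintype ι] [DecidableEq ι]

/-- The energy `K log (2π) + log det S + (x - m)ᵀ S⁻¹ (x - m)` of the Gaussian `N(m, S)` on `ℝᴷ`.
Its density is `exp (-energy / 2)`: the normalizing constant is part of the exponent, so that products
of powers of densities become linear combinations of energies. -/
noncomputable def gaussianEnergy (m : EuclideanSpace ℝ ι) (S : Matrix ι ι ℝ)
    (x : EuclideanSpace ℝ ι) : ℝ :=
  Fintype.card ι * Real.log (2 * Real.pi) + Real.log S.det +
    ofLp (x - m) ⬝ᵥ S⁻¹ *ᵥ ofLp (x - m)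

@[fun_prop]
lemma measurable_gaussianEnergy (m : EuclideanSpace ℝ ι) (S : Matrix ι ι ℝ) :
    Measurable (gaussianEnergy m S) := by
  unfold gaussianEnergy
  simp only [dotProduct, mulVec]
  fun_prop

/-- The two measures have the same characteristic function, by the formula for the Fourier transform
of the Gaussian. -/
lemma stdGaussian_eq_withDensity :
    stdGaussian (EuclideanSpace ℝ ι) = (volume : Measure (EuclideanSpace ℝ ι)).withDensity
      fun x => ENNReal.ofReal (Real.exp (-gaussianEnergy 0 1 x / 2)) := by
  set b : ℝ := Fintype.card ι * Real.log (2 * Real.pi) with hb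
  have hE (x : EuclideanSpace ℝ ι) : Real.exp (-gaussianEnergy 0 1 x / 2) =
      Real.exp (-b / 2) * Real.exp (-(1 / 2) * ‖x‖ ^ 2) := by
    rw [← Real.exp_add, gaussianEnergy, EuclideanSpace.real_norm_sq_eq]
    simp [dotProduct, ← hb]
    ring_nf
  have hint : Integrable (fun x : EuclideanSpace ℝ ι => Real.exp (-gaussianEnergy 0 1 x / 2)) := by
    simp_rw [hE]
    refine Integrable.const_mul ?_ _
    have := (GaussianFourier.integrable_cexp_neg_mul_sq_norm_add (V := EuclideanSpace ℝ ι)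
      (b := 1 / 2) (by norm_num) 0 0).norm
    refine this.congr (.of_forall fun x => ?_)
    simp [Complex.norm_exp, ← Complex.ofReal_pow]
  have : IsFiniteMeasure ((volume : Measure (EuclideanSpace ℝ ι)).withDensity
      fun x => ENNReal.ofReal (Real.exp (-gaussianEnergy 0 1 x / 2))) :=
    isFiniteMeasure_withDensity_ofReal hint.2
  refine Measure.ext_of_charFun ?_
  ext t
  rw [charFun_stdGaussian, charFun_apply, integral_withDensity_eq_integral_toReal_smul
    (by fun_prop) (by simp)]
  have h2 (x : EuclideanSpace ℝ ι) :
      (ENNReal.ofReal (Real.exp (-gaussianEnergy 0 1 x / 2))).toReal •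
        Complex.exp (inner ℝ x t * Complex.I) = Real.exp (-b / 2) *
        Complex.exp (-(1 / 2 : ℂ) * ‖x‖ ^ 2 + Complex.I * inner ℝ t x) := by
    rw [ENNReal.toReal_ofReal (Real.exp_pos _).le, hE, Complex.real_smul, Complex.exp_add,
      real_inner_comm]
    push_cast
    ring_nf
  simp_rw [h2]
  rw [integral_const_mul, GaussianFourier.integral_cexp_neg_mul_sq_norm_add (by norm_num)]
  have h3 : ((Real.pi : ℂ) / (1 / 2)) ^ (Module.finrank ℝ (EuclideanSpace ℝ ι) / 2 : ℂ) =
      Real.exp (b / 2) := by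
    have h2pi : (Real.pi : ℂ) / (1 / 2) = ((2 * Real.pi : ℝ) : ℂ) := by push_cast; ring
    have hc : (Module.finrank ℝ (EuclideanSpace ℝ ι) / 2 : ℂ) =
      ((Fintype.card ι / 2 : ℝ) : ℂ) := by simp
    rw [h2pi, hc, ← Complex.ofReal_cpow (by positivity), Real.rpow_def_of_pos (by positivity), hb]
    ring_nf
  rw [h3, ← mul_assoc, ← Complex.ofReal_mul, ← Real.exp_add]
  have h4 : -b / 2 + b / 2 = 0 := by ring
  rw [h4]
  simp
  ring_nf

/-- Change of variables along `x ↦ m + √S x`, which multiplies Lebesgue measure by `det √S`. -/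
lemma multivariateGaussian_eq_withDensity (m : EuclideanSpace ℝ ι) {S : Matrix ι ι ℝ}
    (hS : S.PosDef) :
    multivariateGaussian m S = (volume : Measure (EuclideanSpace ℝ ι)).withDensity
      fun x => ENNReal.ofReal (Real.exp (-gaussianEnergy m S x / 2)) := by
  set T := CFC.sqrt S with hT
  have hTT : T * T = S := CFC.sqrt_mul_sqrt_self _ hS.posSemidef.nonneg
  have hTs : Tᵀ = T := by
    have := (CFC.sqrt_nonneg S).posSemidef.1
    rwa [IsHermitian, conjTranspose_eq_transpose_of_trivial] at this
  have hdet : T.det * T.det = S.det := by rw [← det_mul, hTT]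
  have hT0 : T.det ≠ 0 := fun h => hS.det_pos.ne' (by rw [← hdet, h, zero_mul])
  set f : EuclideanSpace ℝ ι → EuclideanSpace ℝ ι := fun x => m + toEuclideanCLM (𝕜 := ℝ) T x
    with hf
  have hfm : Measurable f := by fun_prop
  have hdetL : LinearMap.det (toEuclideanCLM (𝕜 := ℝ) T : EuclideanSpace ℝ ι →ₗ[ℝ] _) = T.det := by
    rw [coe_toEuclideanCLM_eq_toEuclideanLin, toEuclideanLin, toLpLin_eq_toLin, LinearMap.det_toLin]
  have hvol : (volume : Measure (EuclideanSpace ℝ ι)) = ENNReal.ofReal |T.det| • volume.map f := by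
    have h1 : f = (fun x => m + x) ∘
      (toEuclideanCLM (𝕜 := ℝ) T : EuclideanSpace ℝ ι →ₗ[ℝ] EuclideanSpace ℝ ι) := rfl
    rw [h1,
      ← Measure.map_map (by fun_prop) (LinearMap.continuous_of_finiteDimensional _).measurable,
      Measure.map_linearMap_addHaar_eq_smul_addHaar _ (by rwa [hdetL]), hdetL, Measure.map_smul,
      map_add_left_eq_self, smul_smul, ← ENNReal.ofReal_mul (abs_nonneg _), ← abs_mul,
      mul_inv_cancel₀ hT0]
    simp
  have hE (x : EuclideanSpace ℝ ι) : gaussianEnergy 0 1 x =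
      gaussianEnergy m S (f x) - 2 * Real.log |T.det| := by
    have hinv : T * S⁻¹ * T = 1 := by
      rw [← hTT, Matrix.mul_inv_rev, ← Matrix.mul_assoc,
        mul_nonsing_inv _ (isUnit_iff_ne_zero.2 hT0),
        Matrix.one_mul, nonsing_inv_mul _ (isUnit_iff_ne_zero.2 hT0)]
    have hq : (T *ᵥ ofLp x) ⬝ᵥ S⁻¹ *ᵥ (T *ᵥ ofLp x) = ofLp x ⬝ᵥ ofLp x := by
      have hadj (v w : ι → ℝ) : (T *ᵥ v) ⬝ᵥ w = v ⬝ᵥ T *ᵥ w := by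
        rw [dotProduct_mulVec, ← mulVec_transpose, hTs]
      rw [hadj, mulVec_mulVec, mulVec_mulVec, hinv, one_mulVec]
    simp only [gaussianEnergy, hf, add_sub_cancel_left, ofLp_toEuclideanCLM, hq, ← hdet,
      Real.log_mul hT0 hT0, Real.log_abs]
    simp
    ring
  ext s hs
  rw [multivariateGaussian, Measure.map_apply hfm hs, stdGaussian_eq_withDensity,
    withDensity_apply _ (hfm hs), withDensity_apply _ hs]
  conv_rhs => rw [hvol, Measure.restrict_smul, lintegral_smul_measure,
    setLIntegral_map hs (by fun_prop) hfm, smul_eq_mul, ← lintegral_const_mul _ (by fun_prop)]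
  refine lintegral_congr fun x => ?_
  rw [← ENNReal.ofReal_mul (abs_nonneg _), hE, ← Real.exp_log (abs_pos.2 hT0), ← Real.exp_add]
  congr 2
  simp
  ring

end GaussianDensity

/-! ### The Rényi divergence of two Gaussians -/

section RenyiGaussian

open Matrix WithLp

variable {ι : Type*} [Fintype ι] [DecidableEq ι]

lemma dotProduct_inv_mulVec_add_smul_mulVec {S : Matrix ι ι ℝ} (hS : S.PosDef) (s : ℝ)
    (z v : ι → ℝ) :
    (z + s • S *ᵥ v) ⬝ᵥ S⁻¹ *ᵥ (z + s • S *ᵥ v) =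
      z ⬝ᵥ S⁻¹ *ᵥ z + 2 * s * (z ⬝ᵥ v) + s ^ 2 * (v ⬝ᵥ S *ᵥ v) := by
  have h := dotProduct_mulVec_comm_of_posSemidef hS.inv.posSemidef (S *ᵥ v) z
  simp only [mulVec_add, mulVec_smul, inv_mulVec_mulVec hS, add_dotProduct, dotProduct_add,
    smul_dotProduct, dotProduct_smul, smul_eq_mul] at h ⊢
  rw [h, dotProduct_comm (S *ᵥ v) v]
  ring

/-- Completing the square: for `M = α S' + (1 - α) S > 0`, the density of `N(m, S)` to the power `α`
times the density of `N(m', S')` to the power `1 - α` is a constant multiple of a Gaussian density.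
Its covariance matrix is `R = S M⁻¹ S'` and its mean is `m + (1 - α) S M⁻¹ (m' - m)`. -/
lemma exists_gaussianEnergy_combination {α : ℝ} (hα : 1 < α) {S S' : Matrix ι ι ℝ} (hS : S.PosDef)
    (hS' : S'.PosDef) {M : Matrix ι ι ℝ} (hM : M.PosDef) (hMS : M = α • S' + (1 - α) • S)
    (m m' : EuclideanSpace ℝ ι) :
    ∃ (c : EuclideanSpace ℝ ι) (R : Matrix ι ι ℝ), R.PosDef ∧ ∀ x,
      α * gaussianEnergy m S x + (1 - α) * gaussianEnergy m' S' x = gaussianEnergy c R x -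
        ((1 - α) * Real.log S.det + α * Real.log S'.det - Real.log M.det +
          α * (α - 1) * (ofLp (m' - m) ⬝ᵥ M⁻¹ *ᵥ ofLp (m' - m))) := by
  have hα0 : 0 < α := by linarith
  have uS := isUnit_iff_ne_zero.2 hS.det_pos.ne'
  have uS' := isUnit_iff_ne_zero.2 hS'.det_pos.ne'
  have uM := isUnit_iff_ne_zero.2 hM.det_pos.ne'
  set v := M⁻¹ *ᵥ ofLp (m' - m) with hv
  have hMv : M *ᵥ v = ofLp (m' - m) := mulVec_inv_mulVec hM _
  refine ⟨m + toLp 2 ((1 - α) • S *ᵥ v), S * M⁻¹ * S', ?_, fun x => ?_⟩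
  · -- In this form `R` is visibly symmetric and positive definite, although `1 - α < 0`.
    have hR : S * M⁻¹ * S' = α⁻¹ • (S + (α - 1) • (S * M⁻¹ * S)) := by
      have h1 : α • S' = M + (α - 1) • S := by rw [hMS]; module
      have h2 : S' = α⁻¹ • (M + (α - 1) • S) := by
        rw [← h1, smul_smul, inv_mul_cancel₀ hα0.ne', one_smul]
      rw [h2, Matrix.mul_smul, Matrix.mul_add, Matrix.mul_assoc S, nonsing_inv_mul _ uM,
        Matrix.mul_one, Matrix.mul_smul]
    rw [hR]
    refine PosDef.smul (hS.add_posSemidef (PosSemidef.smul ?_ (by linarith))) (inv_pos.2 hα0)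
    have := hM.inv.posSemidef.mul_mul_conjTranspose_same S
    rwa [hS.1] at this
  · have hRinv : (S * M⁻¹ * S')⁻¹ = α • S⁻¹ + (1 - α) • S'⁻¹ := by
      rw [Matrix.mul_inv_rev, Matrix.mul_inv_rev, nonsing_inv_nonsing_inv _ uM, hMS, Matrix.add_mul,
        Matrix.mul_add, Matrix.smul_mul, Matrix.smul_mul, Matrix.mul_smul, Matrix.mul_smul,
        mul_nonsing_inv _ uS, ← Matrix.mul_assoc, nonsing_inv_mul _ uS']
      simp
    have hdet : Real.log (S * M⁻¹ * S').det =
        Real.log S.det + Real.log S'.det - Real.log M.det := by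
      have := (inv_pos.2 hM.det_pos).ne'
      rw [det_mul, det_mul, det_nonsing_inv, Ring.inverse_eq_inv',
        Real.log_mul (mul_ne_zero hS.det_pos.ne' this) hS'.det_pos.ne',
        Real.log_mul hS.det_pos.ne' this, Real.log_inv]
      ring
    set z := ofLp (x - (m + toLp 2 ((1 - α) • S *ᵥ v))) with hz
    have h1 : ofLp (x - m) = z + (1 - α) • S *ᵥ v := by
      ext i
      simp [hz]
      ring
    have h2 : ofLp (x - m') = z + (-α) • S' *ᵥ v := by
      have : ofLp (x - m') = ofLp (x - m) - M *ᵥ v := by rw [hMv]; ext i; simp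
      rw [this, h1, hMS, add_mulVec, smul_mulVec, smul_mulVec]
      module
    have hvM : ofLp (m' - m) ⬝ᵥ v = α * (v ⬝ᵥ S' *ᵥ v) + (1 - α) * (v ⬝ᵥ S *ᵥ v) := by
      rw [← hMv, dotProduct_comm, hMS]
      simp [add_mulVec, smul_mulVec]
    simp only [gaussianEnergy]
    rw [h1, h2, dotProduct_inv_mulVec_add_smul_mulVec hS, dotProduct_inv_mulVec_add_smul_mulVec hS',
      hRinv, hdet, hvM]
    simp only [add_mulVec, smul_mulVec, dotProduct_add, dotProduct_smul, smul_eq_mul]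
    ring

lemma multivariateGaussian_eq_withDensity_multivariateGaussian (m m' : EuclideanSpace ℝ ι)
    {S S' : Matrix ι ι ℝ} (hS : S.PosDef) (hS' : S'.PosDef) :
    multivariateGaussian m S = (multivariateGaussian m' S').withDensity fun x =>
      ENNReal.ofReal (Real.exp ((gaussianEnergy m' S' x - gaussianEnergy m S x) / 2)) := by
  rw [multivariateGaussian_eq_withDensity m hS, multivariateGaussian_eq_withDensity m' hS',
    ← withDensity_mul _ (by fun_prop) (by fun_prop)]
  congr 1
  ext x
  rw [Pi.mul_apply, ← ENNReal.ofReal_mul (Real.exp_pos _).le, ← Real.exp_add]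
  ring_nf

/-- The closed form of `E_Q[(dP/dQ)^α]` for `P = N(m, S)` and `Q = N(m', S')`, valid as long as
`M = α S' + (1 - α) S` is positive definite. -/
theorem lintegral_rnDeriv_rpow_multivariateGaussian {α : ℝ} (hα : 1 < α) (m m' : EuclideanSpace ℝ ι)
    {S S' : Matrix ι ι ℝ} (hS : S.PosDef) (hS' : S'.PosDef) {M : Matrix ι ι ℝ} (hM : M.PosDef)
    (hMS : M = α • S' + (1 - α) • S) :
    ∫⁻ x, ((multivariateGaussian m S).rnDeriv (multivariateGaussian m' S') x) ^ α
        ∂multivariateGaussian m' S' =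
      ENNReal.ofReal (Real.exp (((1 - α) * Real.log S.det + α * Real.log S'.det - Real.log M.det +
          α * (α - 1) * (ofLp (m' - m) ⬝ᵥ M⁻¹ *ᵥ ofLp (m' - m))) / 2)) := by
  obtain ⟨c, R, hR, h⟩ := exists_gaussianEnergy_combination hα hS hS' hM hMS m m'
  set J := (1 - α) * Real.log S.det + α * Real.log S'.det - Real.log M.det +
    α * (α - 1) * (ofLp (m' - m) ⬝ᵥ M⁻¹ *ᵥ ofLp (m' - m))
  have hae : (multivariateGaussian m S).rnDeriv (multivariateGaussian m' S')
      =ᵐ[multivariateGaussian m' S'] fun x =>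
        ENNReal.ofReal (Real.exp ((gaussianEnergy m' S' x - gaussianEnergy m S x) / 2)) := by
    conv_lhs => rw [multivariateGaussian_eq_withDensity_multivariateGaussian m m' hS hS']
    exact Measure.rnDeriv_withDensity _ (by fun_prop)
  rw [lintegral_congr_ae (hae.mono fun x hx => by rw [hx])]
  conv_lhs => rw [multivariateGaussian_eq_withDensity m' hS',
    lintegral_withDensity_eq_lintegral_mul _ (by fun_prop) (by fun_prop)]
  have hmass : ∫⁻ x, ENNReal.ofReal (Real.exp (-gaussianEnergy c R x / 2)) = 1 := by
    rw [← setLIntegral_univ, ← withDensity_apply _ .univ,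
      ← multivariateGaussian_eq_withDensity c hR, measure_univ]
  rw [← mul_one (ENNReal.ofReal (Real.exp (J / 2))), ← hmass, ← lintegral_const_mul _ (by fun_prop)]
  refine lintegral_congr fun x => ?_
  rw [Pi.mul_apply, ENNReal.ofReal_rpow_of_pos (Real.exp_pos _), ← Real.exp_mul,
    ← ENNReal.ofReal_mul (Real.exp_pos _).le, ← Real.exp_add,
    ← ENNReal.ofReal_mul (Real.exp_pos _).le, ← Real.exp_add]
  congr 2
  linear_combination -(h x) / 2

end RenyiGaussian

/-! ### Rényi divergence and differential privacy -/

lemma renyiDiv_le_of_lintegral_le {Y : Type*} [MeasurableSpace Y] {α : ℝ} (hα : 1 < α)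
    {P Q : Measure Y} (hPQ : P ≪ Q) {ε : ℝ}
    (h : ∫⁻ y, (P.rnDeriv Q y) ^ α ∂Q ≤ ENNReal.ofReal (Real.exp ((α - 1) * ε))) :
    renyiDiv α P Q ≤ ε := by
  have hα' : 0 < α - 1 := by linarith
  rw [renyiDiv, if_neg (by simp [hPQ])]
  have h1 := ENNReal.log_le_log_iff.2 h
  rw [ENNReal.log_ofReal_of_pos (Real.exp_pos _), Real.log_exp] at h1
  refine (mul_le_mul_of_nonneg_left h1 (by exact_mod_cast (one_div_pos.2 hα').le)).trans_eq ?_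
  rw [← EReal.coe_mul]
  congr 1
  field_simp

lemma lintegral_le_of_renyiDiv_le {Y : Type*} [MeasurableSpace Y] {α : ℝ} (hα : 1 < α)
    {P Q : Measure Y} {ε : ℝ} (h : renyiDiv α P Q ≤ ε) :
    P ≪ Q ∧ ∫⁻ y, (P.rnDeriv Q y) ^ α ∂Q ≤ ENNReal.ofReal (Real.exp ((α - 1) * ε)) := by
  have hα' : 0 < α - 1 := by linarith
  rw [renyiDiv] at h
  split_ifs at h with hc
  · exact absurd h (by simp)
  · refine ⟨by simpa [hα] using hc, ?_⟩
    rw [← ENNReal.log_le_log_iff, ENNReal.log_ofReal_of_pos (Real.exp_pos _), Real.log_exp]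
    have h2 := mul_le_mul_of_nonneg_left h
      (show (0 : EReal) ≤ ((α - 1 : ℝ) : EReal) by exact_mod_cast hα'.le)
    rwa [← mul_assoc, ← EReal.coe_mul, mul_one_div_cancel hα'.ne', EReal.coe_one, one_mul,
      ← EReal.coe_mul] at h2

/-- A bound on the Rényi divergence gives `(ε + log (1/δ) / (α - 1), δ)`-indistinguishability: with
`r` the exponential of the first parameter, `P ≤ r Q` off the set `{dP/dQ > r}`, which has `P`-measure
at most `δ` by Markov's inequality for `(dP/dQ)^(α - 1)` under `P`. -/
lemma measure_le_of_renyiDiv_le {Y : Type*} [MeasurableSpace Y] {α : ℝ} (hα : 1 < α)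
    {P Q : Measure Y} [IsFiniteMeasure P] [IsFiniteMeasure Q] {ε : ℝ} (h : renyiDiv α P Q ≤ ε)
    {δ : ℝ} (hδ : 0 < δ) {A : Set Y} (hA : MeasurableSet A) :
    P A ≤ ENNReal.ofReal (Real.exp (ε + Real.log (1 / δ) / (α - 1))) * Q A + ENNReal.ofReal δ := by
  have hα' : 0 < α - 1 := by linarith
  obtain ⟨hac, hint⟩ := lintegral_le_of_renyiDiv_le hα h
  set f := P.rnDeriv Q
  have hf : Measurable f := Measure.measurable_rnDeriv _ _
  set r := Real.exp (ε + Real.log (1 / δ) / (α - 1)) with hr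
  have hr0 : 0 < r := Real.exp_pos _
  have hrpow : r ^ (α - 1) * δ = Real.exp ((α - 1) * ε) := by
    rw [hr, ← Real.exp_mul]
    conv_lhs => rw [← Real.exp_log hδ, ← Real.exp_add, Real.exp_log hδ, one_div, Real.log_inv]
    congr 1
    field_simp
    ring
  set T := {y | ENNReal.ofReal r < f y} with hT
  have hTm : MeasurableSet T := measurableSet_lt measurable_const hf
  have h1 : P (A \ T) ≤ ENNReal.ofReal r * Q A := by
    rw [← Measure.withDensity_rnDeriv_eq P Q hac, withDensity_apply _ (hA.diff hTm)]
    calc ∫⁻ y in A \ T, f y ∂Q ≤ ∫⁻ _ in A \ T, ENNReal.ofReal r ∂Q :=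
          setLIntegral_mono measurable_const fun y hy => not_lt.1 hy.2
      _ = ENNReal.ofReal r * Q (A \ T) := by simp
      _ ≤ _ := by gcongr; exact Set.sdiff_subset
  have h2 : P T ≤ ENNReal.ofReal δ := by
    have h3 : ENNReal.ofReal (r ^ (α - 1)) * P T ≤
        ENNReal.ofReal (r ^ (α - 1)) * ENNReal.ofReal δ := by
      rw [← ENNReal.ofReal_mul (by positivity), hrpow]
      refine le_trans ?_ hint
      conv_lhs => rw [← Measure.withDensity_rnDeriv_eq P Q hac, withDensity_apply _ hTm]
      rw [← lintegral_const_mul _ hf]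
      refine (setLIntegral_mono (hf.pow_const α) fun y hy => ?_).trans
        (setLIntegral_le_lintegral T _)
      have hy0 : f y ≠ 0 := (bot_lt_of_lt hy).ne'
      calc ENNReal.ofReal (r ^ (α - 1)) * f y ≤ f y ^ (α - 1) * f y := by
            rw [← ENNReal.ofReal_rpow_of_pos hr0]
            gcongr
            exact le_of_lt hy
        _ = f y ^ (α - 1) * f y ^ (1 : ℝ) := by rw [ENNReal.rpow_one]
        _ = f y ^ α := by
          rw [← ENNReal.rpow_add_of_nonneg _ _ hα'.le zero_le_one, sub_add_cancel]
    refine (ENNReal.mul_le_mul_iff_right ?_ ENNReal.ofReal_ne_top).1 h3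
    exact (ENNReal.ofReal_pos.2 (by positivity)).ne'
  calc P A ≤ P ((A \ T) ∪ T) := measure_mono (by simp)
    _ ≤ P (A \ T) + P T := measure_union_le _ _
    _ ≤ _ := add_le_add h1 h2

/-! ### The law of the aggregated update -/

section Aggregation

open Matrix WithLp

lemma measurable_add_toLp_mulVec {ι κ : Type*} [Fintype ι] [Fintype κ] (m : EuclideanSpace ℝ ι)
    (T : Matrix ι κ ℝ) :
    Measurable fun x : EuclideanSpace ℝ κ => m + toLp 2 (T *ᵥ ofLp x) := by
  classical
  have : Continuous fun x : EuclideanSpace ℝ κ => T *ᵥ ofLp x :=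
    (Matrix.toLin' T).continuous_of_finiteDimensional.comp (PiLp.continuous_ofLp 2 _)
  exact (continuous_const.add ((PiLp.continuous_toLp 2 _).comp this)).measurable

lemma charFun_map_add_mulVec_stdGaussian {ι κ : Type*} [Fintype ι] [Fintype κ]
    (m : EuclideanSpace ℝ ι) (T : Matrix ι κ ℝ) (t : EuclideanSpace ℝ ι) :
    charFun ((stdGaussian (EuclideanSpace ℝ κ)).map fun x => m + toLp 2 (T *ᵥ ofLp x)) t =
      Complex.exp (inner ℝ t m * Complex.I - ofLp t ⬝ᵥ (T * Tᵀ) *ᵥ ofLp t / 2) := by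
  have hinner (x : EuclideanSpace ℝ κ) : inner ℝ (m + toLp 2 (T *ᵥ ofLp x)) t =
      inner ℝ t m + inner ℝ x (toLp 2 (Tᵀ *ᵥ ofLp t)) := by
    rw [inner_add_left, real_inner_comm]
    congr 1
    rw [EuclideanSpace.inner_eq_star_dotProduct, EuclideanSpace.inner_eq_star_dotProduct]
    simp only [star_trivial]
    rw [dotProduct_mulVec, mulVec_transpose]
  have hnorm : ‖(toLp 2 (Tᵀ *ᵥ ofLp t) : EuclideanSpace ℝ κ)‖ ^ 2 =
      ofLp t ⬝ᵥ (T * Tᵀ) *ᵥ ofLp t := by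
    rw [EuclideanSpace.real_norm_sq_eq, ← mulVec_mulVec, dotProduct_mulVec, ← mulVec_transpose]
    simp [dotProduct, sq]
  rw [charFun_apply, integral_map (measurable_add_toLp_mulVec m T).aemeasurable (by fun_prop)]
  simp_rw [hinner, Complex.ofReal_add, add_mul, Complex.exp_add]
  rw [integral_const_mul, ← charFun_apply, charFun_stdGaussian, ← Complex.exp_add, ← hnorm]
  push_cast
  ring_nf

variable {𝒳 : Type*} {N K D : ℕ} (L : EuclideanSpace ℝ (Fin K) → 𝒳 → ℝ)
  (θ : EuclideanSpace ℝ (Fin K)) (C : ℝ)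

/-- The mean `∑_i (1/D) G_i 𝟙` of the aggregated model update. -/
noncomputable def updateMean (d : Fin N → Fin D → 𝒳) : EuclideanSpace ℝ (Fin K) :=
  ∑ i, toLp 2 (gradMatrix L θ C (d i) *ᵥ fun _ => 1 / (D : ℝ))

/-- The covariance matrix `(1/B) ∑_i Σ_i` of the aggregated model update. -/
noncomputable def updateCov (B : ℝ) (d : Fin N → Fin D → 𝒳) : Matrix (Fin K) (Fin K) ℝ :=
  (1 / B) • ∑ i, gradCov L θ C (d i)

lemma posSemidef_gradCov (d : Fin D → 𝒳) : (gradCov L θ C d).PosSemidef := by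
  refine PosSemidef.smul ?_ (by positivity)
  simpa [conjTranspose_eq_transpose_of_trivial] using
    posSemidef_self_mul_conjTranspose (gradMatrix L θ C d)

lemma posSemidef_updateCov {B : ℝ} (hB : 0 < B) (d : Fin N → Fin D → 𝒳) :
    (updateCov L θ C B d).PosSemidef :=
  PosSemidef.smul (posSemidef_sum _ fun i _ => posSemidef_gradCov L θ C (d i)) (by positivity)

theorem aggregatedLaw_eq_multivariateGaussian {Ω : Type*} [MeasurableSpace Ω] {μ : Measure Ω}
    [IsProbabilityMeasure μ] (hD : 0 < D) {B : ℝ} (hB : 0 < B)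
    {w : Fin N → Ω → EuclideanSpace ℝ (Fin D)} (hw : IsGaussianSamplingNoise μ B w)
    (d : Fin N → Fin D → 𝒳) :
    aggregatedLaw μ w L θ C d =
      multivariateGaussian (updateMean L θ C d) (updateCov L θ C B d) := by
  have hD' : (0 : ℝ) < D := by exact_mod_cast hD
  choose ξ hξ hwξ using hw.gaussian
  have hX (i : Fin N) : (fun ω => (toLp 2 (gradMatrix L θ C (d i) *ᵥ ofLp (w i ω)) :
      EuclideanSpace ℝ (Fin K))) =
        (fun x => toLp 2 (gradMatrix L θ C (d i) *ᵥ fun _ => 1 / (D : ℝ)) +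
        toLp 2 (((1 / √(B * D)) • gradMatrix L θ C (d i)) *ᵥ ofLp x)) ∘ ξ i := by
    ext1 ω
    have : ofLp (w i ω) = (fun _ => 1 / (D : ℝ)) + (1 / √(B * D)) • ofLp (ξ i ω) := by
      ext j; simp [hwξ]
    rw [this, mulVec_add, mulVec_smul, toLp_add, Function.comp_apply, smul_mulVec]
  have hXm (i : Fin N) : AEMeasurable (fun ω => (toLp 2 (gradMatrix L θ C (d i) *ᵥ ofLp (w i ω)) :
      EuclideanSpace ℝ (Fin K))) μ := by
    rw [hX]
    exact (measurable_add_toLp_mulVec _ _).comp_aemeasurable (hξ i).aemeasurable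
  have hind := hw.indep.comp _ fun i => by
    simpa using measurable_add_toLp_mulVec 0 (gradMatrix L θ C (d i))
  have hagg : (fun ω => aggregatedUpdate L θ C d fun i => w i ω) =
      fun ω => ∑ i, (toLp 2 (gradMatrix L θ C (d i) *ᵥ ofLp (w i ω)) : EuclideanSpace ℝ (Fin K)) :=
    rfl
  rw [aggregatedLaw, hagg]
  have : IsProbabilityMeasure (μ.map fun ω => ∑ i, (toLp 2 (gradMatrix L θ C (d i) *ᵥ
      ofLp (w i ω)) : EuclideanSpace ℝ (Fin K))) :=
    Measure.isProbabilityMeasure_map (Finset.aemeasurable_fun_sum _ fun i _ => hXm i)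
  refine Measure.ext_of_charFun ?_
  ext t
  have hprod := iIndepFun.charFun_map_fun_sum_eq_prod hXm hind
  rw [hprod, Finset.prod_apply, charFun_multivariateGaussian (posSemidef_updateCov L θ C hB d)]
  have hterm (i : Fin N) : charFun (μ.map fun ω =>
      (toLp 2 (gradMatrix L θ C (d i) *ᵥ ofLp (w i ω)) : EuclideanSpace ℝ (Fin K))) t = Complex.exp (
        inner ℝ t (toLp 2 (gradMatrix L θ C (d i) *ᵥ fun _ => 1 / (D : ℝ))) * Complex.I -
        ofLp t ⬝ᵥ ((1 / B) • gradCov L θ C (d i)) *ᵥ ofLp t / 2) := by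
    rw [hX, ← AEMeasurable.map_map_of_aemeasurable (measurable_add_toLp_mulVec _ _).aemeasurable
      (hξ i).aemeasurable,
      (hξ i).map_eq, charFun_map_add_mulVec_stdGaussian]
    have hcov : ((1 / √(B * D)) • gradMatrix L θ C (d i)) *
        ((1 / √(B * D)) • gradMatrix L θ C (d i))ᵀ = (1 / B) • gradCov L θ C (d i) := by
      rw [gradCov, transpose_smul, Matrix.smul_mul, Matrix.mul_smul, smul_smul, smul_smul,
        div_mul_div_comm, Real.mul_self_sqrt (by positivity), div_mul_div_comm]
    rw [hcov]
  simp_rw [hterm]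
  rw [← Complex.exp_sum]
  congr 1
  rw [updateMean, updateCov, inner_sum, Finset.smul_sum, sum_mulVec, dotProduct_sum]
  push_cast
  rw [Finset.sum_sub_distrib, Finset.sum_mul, Finset.sum_div]

end Aggregation

/-! ### Gaussians whose covariances differ by a rank-two perturbation -/

section RankTwo

open Matrix WithLp

variable {ι : Type*} [Fintype ι]

lemma le_dotProduct_add_smul_vecMulVec_sub_mulVec {S : Matrix ι ι ℝ} {s : ℝ}
    (h : ∀ x, s * (x ⬝ᵥ x) ≤ x ⬝ᵥ S *ᵥ x) {u v : ι → ℝ} {t b : ℝ} (ht : 0 ≤ t) (hv : v ⬝ᵥ v ≤ b)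
    (x : ι → ℝ) :
    (s - t * b) * (x ⬝ᵥ x) ≤ x ⬝ᵥ (S + t • (vecMulVec u u - vecMulVec v v)) *ᵥ x := by
  have hx : 0 ≤ x ⬝ᵥ x := by simpa using dotProduct_star_self_nonneg x
  have hcs : (x ⬝ᵥ v) ^ 2 ≤ (x ⬝ᵥ x) * (v ⬝ᵥ v) := by
    simpa [dotProduct, sq] using Finset.sum_mul_sq_le_sq_mul_sq Finset.univ x v
  have h1 : (x ⬝ᵥ v) ^ 2 ≤ (x ⬝ᵥ x) * b := hcs.trans (by gcongr)
  have h2 : x ⬝ᵥ (S + t • (vecMulVec u u - vecMulVec v v)) *ᵥ x =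
      x ⬝ᵥ S *ᵥ x + t * ((x ⬝ᵥ u) ^ 2 - (x ⬝ᵥ v) ^ 2) := by
    simp only [add_mulVec, smul_mulVec, sub_mulVec, vecMulVec_mulVec, dotProduct_add,
      dotProduct_smul, dotProduct_sub, smul_eq_mul, dotProduct_comm _ x, op_smul_eq_smul]
    ring
  have h3 := mul_le_mul_of_nonneg_left h1 ht
  have h4 : 0 ≤ t * (x ⬝ᵥ u) ^ 2 := by positivity
  rw [h2]
  linarith [h x]

variable [DecidableEq ι]

/-- If `S ≥ s` and the squared norms of `u`, `v` are at most `b`, the divergence is the sum of a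
term for the shift of the mean and a term for the change `t (u uᵀ - v vᵀ)` of the covariance, both
governed by the gap `s - α t b`, a lower bound for `M = S + α t (u uᵀ - v vᵀ)`. -/
theorem renyiDiv_multivariateGaussian_le {α : ℝ} (hα : 1 < α) {S : Matrix ι ι ℝ}
    (hS : S.IsHermitian) {s : ℝ} (h : ∀ x, s * (x ⬝ᵥ x) ≤ x ⬝ᵥ S *ᵥ x) {u v : ι → ℝ} {t b : ℝ}
    (ht : 0 ≤ t) (hu : u ⬝ᵥ u ≤ b) (hv : v ⬝ᵥ v ≤ b) (hs : α * (t * b) < s)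
    (m m' : EuclideanSpace ℝ ι) :
    renyiDiv α (multivariateGaussian m S)
        (multivariateGaussian m' (S + t • (vecMulVec u u - vecMulVec v v))) ≤
      ((α / 2 * ((ofLp (m' - m) ⬝ᵥ ofLp (m' - m)) / (s - α * (t * b))) +
        α * (t * b) / ((α - 1) * (s - α * (t * b))) : ℝ) : EReal) := by
  have hα0 : 0 < α := by linarith
  have hα1 : 0 < α - 1 := by linarith
  have hnn (x : ι → ℝ) : 0 ≤ x ⬝ᵥ x := by simpa using dotProduct_star_self_nonneg x
  have hb : 0 ≤ b := (hnn u).trans hu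
  have htb : 0 ≤ t * b := by positivity
  have hs0 : 0 < s := lt_of_le_of_lt (by positivity) hs
  have hgap : 0 < s - α * (t * b) := by linarith
  have hSp : S.PosDef := posDef_of_le_dotProduct_mulVec hS hs0 h
  have hherm (τ : ℝ) : (S + τ • (vecMulVec u u - vecMulVec v v)).IsHermitian := by
    refine hS.add ?_
    ext i j
    simp [vecMulVec_apply, mul_comm]
  have hlow (τ : ℝ) (hτ : 0 ≤ τ) :=
    le_dotProduct_add_smul_vecMulVec_sub_mulVec (u := u) h hτ hv
  have hS' : (S + t • (vecMulVec u u - vecMulVec v v)).PosDef :=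
    posDef_of_le_dotProduct_mulVec (hherm t) (by nlinarith) (hlow t ht)
  have hMlow (x : ι → ℝ) : (s - α * (t * b)) * (x ⬝ᵥ x) ≤
      x ⬝ᵥ (S + (α * t) • (vecMulVec u u - vecMulVec v v)) *ᵥ x := by
    rw [← mul_assoc]
    exact hlow _ (by positivity) x
  have hM : (S + (α * t) • (vecMulVec u u - vecMulVec v v)).PosDef :=
    posDef_of_le_dotProduct_mulVec (hherm _) hgap hMlow
  have hMS : S + (α * t) • (vecMulVec u u - vecMulVec v v) =
      α • (S + t • (vecMulVec u u - vecMulVec v v)) + (1 - α) • S := by module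
  refine renyiDiv_le_of_lintegral_le hα ?_ ?_
  · rw [multivariateGaussian_eq_withDensity_multivariateGaussian m m' hSp hS']
    exact withDensity_absolutelyContinuous _ _
  rw [lintegral_rnDeriv_rpow_multivariateGaussian hα m m' hSp hS' hM hMS]
  refine ENNReal.ofReal_le_ofReal (Real.exp_le_exp.2 ?_)
  have hquad := dotProduct_inv_mulVec_le hM hgap hMlow (ofLp (m' - m))
  have hdetS' := det_add_smul_vecMulVec_sub hSp t u v
  have hdetM := det_add_smul_vecMulVec_sub hSp (α * t) u v
  set p := u ⬝ᵥ S⁻¹ *ᵥ u with hp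
  set q := v ⬝ᵥ S⁻¹ *ᵥ v with hq
  set r := u ⬝ᵥ S⁻¹ *ᵥ v with hr
  have hp0 : 0 ≤ p := by simpa using hSp.inv.posSemidef.dotProduct_mulVec_nonneg u
  have hq0 : 0 ≤ q := by simpa using hSp.inv.posSemidef.dotProduct_mulVec_nonneg v
  have hpb : p ≤ b / s := (dotProduct_inv_mulVec_le hSp hs0 h u).trans (by gcongr)
  have hqb : q ≤ b / s := (dotProduct_inv_mulVec_le hSp hs0 h v).trans (by gcongr)
  have hr2 : r ^ 2 ≤ p * q := sq_dotProduct_mulVec_le hSp.inv.posSemidef u v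
  have hts : α * (t * b / s) < 1 := by
    rw [← mul_div_assoc, div_lt_one hs0]; exact hs
  have hpos' := hS'.det_pos
  have hposM := hM.det_pos
  rw [hdetS'] at hpos'
  rw [hdetM] at hposM
  rw [hdetS', hdetM, Real.log_mul hSp.det_pos.ne' (pos_of_mul_pos_right hpos' hSp.det_pos.le).ne',
    Real.log_mul hSp.det_pos.ne' (pos_of_mul_pos_right hposM hSp.det_pos.le).ne']
  have hlog := mul_log_sub_log_le (a := t * p) (b := t * q) (c := t * b / s) (r := t * r) hα
    (by positivity) (by rw [mul_div_assoc]; gcongr) (by positivity)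
    (by rw [mul_div_assoc]; gcongr) hts (by nlinarith [mul_le_mul_of_nonneg_left hr2 (sq_nonneg t)])
  have hfrac : 2 * (α * (t * b / s)) / (1 - α * (t * b / s)) =
      2 * (α * (t * b)) / (s - α * (t * b)) := by
    have : 1 - α * (t * b / s) = (s - α * (t * b)) / s := by field_simp
    rw [this]
    field_simp
  have hassoc : (1 + α * (t * p)) * (1 - α * (t * q)) + α ^ 2 * (t * r) ^ 2 =
      (1 + α * t * p) * (1 - α * t * q) + (α * t) ^ 2 * r ^ 2 := by ring
  rw [hfrac, hassoc, mul_pow t r] at hlog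
  have hbound : (α - 1) * (α / 2 * ((ofLp (m' - m) ⬝ᵥ ofLp (m' - m)) / (s - α * (t * b))) +
      α * (t * b) / ((α - 1) * (s - α * (t * b)))) =
      (2 * (α * (t * b)) / (s - α * (t * b)) +
        α * (α - 1) * ((ofLp (m' - m) ⬝ᵥ ofLp (m' - m)) / (s - α * (t * b)))) / 2 := by
    field_simp
    ring
  rw [hbound]
  have := mul_le_mul_of_nonneg_left hquad (mul_pos hα0 hα1).le
  linarith

end RankTwo

/-! ### Replacing one data point -/

section Adjacency

open Matrix WithLp

lemma norm_clip_le {K : ℕ} (x : EuclideanSpace ℝ (Fin K)) {C : ℝ} (hC : 0 < C) :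
    ‖clip x C‖ ≤ C := by
  have hmax : 0 < max ‖x‖ C := lt_max_of_lt_right hC
  rw [clip, norm_smul, Real.norm_of_nonneg (by positivity), div_mul_eq_mul_div, div_le_iff₀ hmax]
  gcongr
  exact le_max_left _ _

variable {𝒳 : Type*} {N K D : ℕ} (L : EuclideanSpace ℝ (Fin K) → 𝒳 → ℝ)
  (θ : EuclideanSpace ℝ (Fin K)) (C : ℝ)

lemma dotProduct_col_gradMatrix_le {C : ℝ} (hC : 0 < C) (d : Fin D → 𝒳) (j : Fin D) :
    (gradMatrix L θ C d).col j ⬝ᵥ (gradMatrix L θ C d).col j ≤ C ^ 2 := by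
  have h : (gradMatrix L θ C d).col j = ofLp (clip (gradient (fun ϑ => L ϑ (d j)) θ) C) := rfl
  have h2 : (gradMatrix L θ C d).col j ⬝ᵥ (gradMatrix L θ C d).col j =
      ‖clip (gradient (fun ϑ => L ϑ (d j)) θ) C‖ ^ 2 := by
    rw [h, EuclideanSpace.real_norm_sq_eq]
    simp [dotProduct, sq]
  rw [h2]
  have := norm_clip_le (gradient (fun ϑ => L ϑ (d j)) θ) hC
  gcongr

lemma gradCov_eq_add_of_eq_off {d d' : Fin D → 𝒳} {k : Fin D} (h : ∀ l, l ≠ k → d' l = d l) :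
    gradCov L θ C d' = gradCov L θ C d + (1 / (D : ℝ)) •
      (vecMulVec ((gradMatrix L θ C d').col k) ((gradMatrix L θ C d').col k) -
        vecMulVec ((gradMatrix L θ C d).col k) ((gradMatrix L θ C d).col k)) := by
  rw [gradCov, gradCov, ← smul_add]
  congr 1
  rw [← sub_eq_iff_eq_add']
  ext a b
  simp only [Matrix.sub_apply, Matrix.mul_apply, transpose_apply, vecMulVec_apply, col_apply,
    ← Finset.sum_sub_distrib]
  refine Finset.sum_eq_single k (fun l _ hl => ?_) (by simp)
  simp [gradMatrix, h l hl]

lemma updateCov_of_adjacent (B : ℝ) {i : Fin N} {d d' : Fin N → Fin D → 𝒳}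
    (hi : ∀ j, j ≠ i → d' j = d j) {k : Fin D} (hk : ∀ l, l ≠ k → d' i l = d i l) :
    updateCov L θ C B d' = updateCov L θ C B d + (1 / (B * D)) •
      (vecMulVec ((gradMatrix L θ C (d' i)).col k) ((gradMatrix L θ C (d' i)).col k) -
        vecMulVec ((gradMatrix L θ C (d i)).col k) ((gradMatrix L θ C (d i)).col k)) := by
  have h : ∑ j, gradCov L θ C (d' j) - ∑ j, gradCov L θ C (d j) =
      gradCov L θ C (d' i) - gradCov L θ C (d i) := by
    rw [← Finset.sum_sub_distrib]
    exact Finset.sum_eq_single i (fun j _ hj => by rw [hi j hj, sub_self]) (by simp)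
  rw [gradCov_eq_add_of_eq_off L θ C hk, add_sub_cancel_left, sub_eq_iff_eq_add'] at h
  rw [updateCov, updateCov, h, smul_add, smul_smul, one_div_mul_one_div]

lemma updateMean_sub_of_adjacent {i : Fin N} {d d' : Fin N → Fin D → 𝒳}
    (hi : ∀ j, j ≠ i → d' j = d j) {k : Fin D} (hk : ∀ l, l ≠ k → d' i l = d i l) :
    ofLp (updateMean L θ C d' - updateMean L θ C d) =
      (1 / (D : ℝ)) • ((gradMatrix L θ C (d' i)).col k - (gradMatrix L θ C (d i)).col k) := by
  rw [updateMean, updateMean, ← Finset.sum_sub_distrib,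
    Finset.sum_eq_single i (fun j _ hj => by rw [hi j hj, sub_self]) (by simp)]
  ext a
  simp only [ofLp_sub, Pi.sub_apply, mulVec, dotProduct, ← Finset.sum_sub_distrib, Pi.smul_apply,
    col_apply, smul_eq_mul]
  rw [Finset.sum_eq_single k (fun l _ hl => by simp [gradMatrix, hk l hl]) (by simp)]
  ring

lemma le_dotProduct_updateCov_mulVec {B : ℝ} (hB : 0 < B) {lam : Fin N → ℝ}
    {d : Fin N → Fin D → 𝒳} (hd : d ∈ nonsingularData D L θ C lam) (x : Fin K → ℝ) :
    (∑ i, lam i) / B * (x ⬝ᵥ x) ≤ x ⬝ᵥ updateCov L θ C B d *ᵥ x := by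
  have h (i : Fin N) : lam i * (x ⬝ᵥ x) ≤ x ⬝ᵥ gradCov L θ C (d i) *ᵥ x :=
    le_dotProduct_mulVec_of_eigenvalues (posSemidef_gradCov L θ C (d i)).1 (hd i).2 x
  rw [updateCov, smul_mulVec, sum_mulVec, dotProduct_smul, dotProduct_sum, smul_eq_mul,
    div_mul_eq_mul_div, Finset.sum_mul, div_eq_mul_one_div, mul_comm]
  gcongr with i
  exact h i

lemma dotProduct_sub_self_le {n : Type*} [Fintype n] {u v : n → ℝ} {b : ℝ} (hu : u ⬝ᵥ u ≤ b)
    (hv : v ⬝ᵥ v ≤ b) : (u - v) ⬝ᵥ (u - v) ≤ 4 * b := by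
  have h : 0 ≤ (u + v) ⬝ᵥ (u + v) := by simpa using dotProduct_star_self_nonneg (u + v)
  simp only [add_dotProduct, dotProduct_add, sub_dotProduct, dotProduct_sub,
    dotProduct_comm v u] at h ⊢
  linarith

theorem isRDPOn_aggregatedLaw {Ω : Type*} [MeasurableSpace Ω] {μ : Measure Ω}
    [IsProbabilityMeasure μ] (hD : 0 < D) {B C α : ℝ} (hB : 0 < B) (hC : 0 < C)
    {w : Fin N → Ω → EuclideanSpace ℝ (Fin D)} (hw : IsGaussianSamplingNoise μ B w)
    {lam : Fin N → ℝ} (hα : 1 < α) (hsum : α * C ^ 2 / D < ∑ i, lam i) (i : Fin N) :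
    IsRDPOn (nonsingularData D L θ C lam) (adjacentFor i) (aggregatedLaw μ w L θ C)
      α (rdpBound D B C α lam) := by
  rintro d hd d' ⟨hi, k, hk⟩
  have hD' : (0 : ℝ) < D := by exact_mod_cast hD
  have hα0 : 0 < α := by linarith
  have hα1 : 0 < α - 1 := by linarith
  have hgap : 0 < ∑ i, lam i - α * C ^ 2 / D := by linarith
  -- The general bound is applied with `s = (∑ i, lam i) / B`, `t = 1 / (B D)` and `b = C ^ 2`.
  have hscale : (∑ i, lam i) / B - α * (1 / (B * D) * C ^ 2) =
      (∑ i, lam i - α * C ^ 2 / D) / B := by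
    field_simp
  have hu := dotProduct_col_gradMatrix_le L θ hC (d' i) k
  have hv := dotProduct_col_gradMatrix_le L θ hC (d i) k
  rw [aggregatedLaw_eq_multivariateGaussian L θ C hD hB hw,
    aggregatedLaw_eq_multivariateGaussian L θ C hD hB hw, updateCov_of_adjacent L θ C B hi hk]
  refine (renyiDiv_multivariateGaussian_le hα (posSemidef_updateCov L θ C hB d).1
    (le_dotProduct_updateCov_mulVec L θ C hB hd) (by positivity) hu hv
    (sub_pos.1 (by rw [hscale]; positivity)) _ _).trans (EReal.coe_le_coe_iff.2 ?_)
  rw [hscale, updateMean_sub_of_adjacent L θ C hi hk]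
  have hdiff := dotProduct_sub_self_le hu hv
  rw [smul_dotProduct, dotProduct_smul, smul_eq_mul, smul_eq_mul]
  calc _ ≤ α / 2 * (1 / (D : ℝ) * (1 / (D : ℝ) * (4 * C ^ 2)) /
        ((∑ i, lam i - α * C ^ 2 / D) / B)) + α * (1 / (B * D) * C ^ 2) /
          ((α - 1) * ((∑ i, lam i - α * C ^ 2 / D) / B)) := by gcongr
    _ = rdpBound D B C α lam := by
      rw [rdpBound]
      generalize ∑ i, lam i - α * C ^ 2 / D = g at hgap
      field_simp
      ring

end Adjacency

theorem theorem2 {Ω : Type*} [MeasurableSpace Ω] (μ : Measure Ω) [IsProbabilityMeasure μ]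
    {𝒳 : Type*} {N K D : ℕ} (hD : 0 < D)
    (L : EuclideanSpace ℝ (Fin K) → 𝒳 → ℝ) (θ : EuclideanSpace ℝ (Fin K))
    (B C α : ℝ) (hB : 0 < B) (hC : 0 < C)
    (w : Fin N → Ω → EuclideanSpace ℝ (Fin D)) (hw : IsGaussianSamplingNoise μ B w)
    (lam : Fin N → ℝ) (hlam : ∀ i, 0 < lam i)
    (hα : 1 < α) (hsum : α * C ^ 2 / D < ∑ i, lam i) (i : Fin N) :
    IsRDPOn (nonsingularData D L θ C lam) (adjacentFor i) (aggregatedLaw μ w L θ C)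
        α (rdpBound D B C α lam) ∧
      ∀ δ : ℝ, 0 < δ →
        IsDPOn (nonsingularData D L θ C lam) (adjacentFor i) (aggregatedLaw μ w L θ C)
          (rdpBound D B C α lam + Real.log (1 / δ) / (α - 1)) δ := by
  have hrdp := isRDPOn_aggregatedLaw L θ hD hB hC hw hα hsum i
  refine ⟨hrdp, fun δ hδ d hd d' hdd' A hA => ?_⟩
  have : IsFiniteMeasure (aggregatedLaw μ w L θ C d) := by unfold aggregatedLaw; infer_instance
  have : IsFiniteMeasure (aggregatedLaw μ w L θ C d') := by unfold aggregatedLaw; infer_instance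
  exact measure_le_of_renyiDiv_le hα (hrdp d hd d' hdd') hδ hA
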